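/- **Lemma 2.3 (Brouwer-based Implicit Function Theorem).** Let $F:\mathbb{R}^m\times\mathbb{R}^n\to\mathbb{R}^m$ be continuous on a neighborhood of the origin, with $F(0,0)=0$. Assume that $\delta\mapsto F(\delta,0)$ is differentiable at $\delta=0$ and that its derivative $\partial_\delta F(0,0):\mathbb{R}^m\to\mathbb{R}^m$ is invertible. Then there exist $r>0$ and a map $a\mapsto\delta(a)\in\mathbb{R}^m$, defined for $a\in\mathbb{R}^n$ with $|a|<r$, such that $F(\delta(a),a)=0$ for all $|a|<r$, $\delta(0)=0$, and $\delta(\cdot)$ is continuous at $a=0$. -/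

import Mathlib

open Metric Set Filter Topology MeasureTheory

/-! Composing with the inverse derivative makes the map at parameter 0 tangent to the identity. On a
small ball of radius ε, nearby parameters keep it within ε/2 of the identity, so Brouwer yields a
zero there (`eventually_exists_eq_zero`). Choosing zeros of almost minimal norm gives continuity at
0. Brouwer follows from the absence of C¹ retractions `r` onto the sphere: ∫ det(1 + t(r' - 1)) over
the unit ball is polynomial in t, equals the ball's volume for small t > 0, and vanishes at t = 1.
-/

/-- The radial retraction of a normed space onto its closed unit ball. -/
noncomputable def unitBallProj {E : Type*} [NormedAddCommGroup E] [NormedSpace ℝ E] (x : E) : E :=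
  (max 1 ‖x‖)⁻¹ • x

section unitBallProj

variable {E : Type*} [NormedAddCommGroup E] [NormedSpace ℝ E]

theorem unitBallProj_of_norm_le {x : E} (hx : ‖x‖ ≤ 1) : unitBallProj x = x := by
  simp [unitBallProj, max_eq_left hx]

theorem norm_unitBallProj_le (x : E) : ‖unitBallProj x‖ ≤ 1 := by
  have h : 0 < max 1 ‖x‖ := by positivity
  rw [unitBallProj, norm_smul, norm_inv, Real.norm_of_nonneg h.le, inv_mul_le_iff₀ h, mul_one]
  exact le_max_right _ _

theorem norm_unitBallProj_of_one_le {x : E} (hx : 1 ≤ ‖x‖) : ‖unitBallProj x‖ = 1 := by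
  rw [unitBallProj, max_eq_right hx, norm_smul, norm_inv, norm_norm, inv_mul_cancel₀]
  linarith

/-- Changing the vector and changing the scaling factor each cost at most ‖x - y‖. -/
theorem lipschitzWith_unitBallProj : LipschitzWith 2 (unitBallProj : E → E) := by
  refine LipschitzWith.of_dist_le_mul fun x y => ?_
  have ha1 : (1 : ℝ) ≤ max 1 ‖x‖ := le_max_left _ _
  have hb1 : (1 : ℝ) ≤ max 1 ‖y‖ := le_max_left _ _
  have hyb : ‖y‖ ≤ max 1 ‖y‖ := le_max_right _ _
  have hab : |max 1 ‖y‖ - max 1 ‖x‖| ≤ ‖x - y‖ := by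
    rw [max_comm 1, max_comm 1, norm_sub_rev]
    exact (abs_max_sub_max_le_abs _ _ _).trans (abs_norm_sub_norm_le y x)
  simp only [dist_eq_norm, unitBallProj]
  generalize max 1 ‖x‖ = a at *
  generalize max 1 ‖y‖ = b at *
  have ha : 0 < a := by linarith
  have hb : 0 < b := by linarith
  have e : a⁻¹ • x - b⁻¹ • y = a⁻¹ • (x - y) + ((b - a) * (a⁻¹ * b⁻¹)) • y := by
    rw [smul_sub, sub_add, ← sub_smul]
    congr 2
    field_simp
    ring
  have h1 : ‖a⁻¹ • (x - y)‖ ≤ ‖x - y‖ := by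
    rw [norm_smul, norm_inv, Real.norm_of_nonneg ha.le]
    exact mul_le_of_le_one_left (norm_nonneg _) (inv_le_one_of_one_le₀ ha1)
  have h2 : ‖((b - a) * (a⁻¹ * b⁻¹)) • y‖ ≤ ‖x - y‖ := by
    rw [norm_smul, norm_mul, norm_mul, norm_inv, norm_inv, Real.norm_of_nonneg ha.le,
      Real.norm_of_nonneg hb.le, Real.norm_eq_abs, mul_assoc]
    refine (mul_le_of_le_one_right (abs_nonneg _) ?_).trans hab
    rw [mul_assoc]
    refine mul_le_one₀ (inv_le_one_of_one_le₀ ha1) (by positivity) ?_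
    rwa [inv_mul_le_iff₀ hb, mul_one]
  rw [e]
  refine (norm_add_le _ _).trans ?_
  push_cast
  linarith

end unitBallProj

/-! ### No-retraction theorem via the volume polynomial -/

/-- A polynomial identity: `det (1 + A)` is an affine combination of the `det (1 + tᵢ • A)` for any
`dim E + 1` distinct nodes `tᵢ`. -/
theorem ContinuousLinearMap.det_one_add_eq_sum_lagrange {E : Type*} [NormedAddCommGroup E]
    [NormedSpace ℝ E] [FiniteDimensional ℝ E] {v : ℕ → ℝ}
    (hv : InjOn v (Finset.range (Module.finrank ℝ E + 1))) (A : E →L[ℝ] E) :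
    (1 + A).det = ∑ i ∈ Finset.range (Module.finrank ℝ E + 1),
      (1 + v i • A).det *
        (Lagrange.basis (Finset.range (Module.finrank ℝ E + 1)) v i).eval 1 := by
  let b := Module.finBasis ℝ E
  let M := LinearMap.toMatrix b b (A : E →ₗ[ℝ] E)
  let p : Polynomial ℝ :=
    ((Polynomial.X : Polynomial ℝ) • M.map Polynomial.C + (1 : Matrix _ _ ℝ).map Polynomial.C).det
  have hp (t : ℝ) : p.eval t = (1 + t • A).det := by
    rw [← Polynomial.coe_evalRingHom, RingHom.map_det, ContinuousLinearMap.det,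
      ← LinearMap.det_toMatrix b]
    congr 1
    ext i j
    simp [M, add_comm, Matrix.one_apply, LinearMap.toMatrix_apply, Finsupp.single_apply, eq_comm]
    split_ifs <;> simp only [Polynomial.eval_one, Polynomial.eval_zero] <;> ring
  have hdeg : p.degree < (Finset.range (Module.finrank ℝ E + 1)).card := by
    refine (Polynomial.degree_le_of_natDegree_le
      (Polynomial.natDegree_det_X_add_C_le M 1)).trans_lt ?_
    rw [Finset.card_range, Fintype.card_fin]
    exact_mod_cast Nat.lt_succ_self _
  have h := congrArg (Polynomial.eval 1) (Lagrange.eq_interpolate hv hdeg)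
  rw [hp, one_smul, Lagrange.interpolate_apply, Polynomial.eval_finsetSum] at h
  simpa [hp] using h

theorem exists_pos_forall_det_one_add_pos {E : Type*} [NormedAddCommGroup E]
    [NormedSpace ℝ E] [FiniteDimensional ℝ E] :
    ∃ ε > 0, ∀ A : E →L[ℝ] E, ‖A‖ < ε → 0 < (1 + A).det := by
  have hc : Continuous fun A : E →L[ℝ] E => (1 + A).det :=
    ContinuousLinearMap.continuous_det.comp (continuous_const.add continuous_id)
  have h0 : (0 : ℝ) < (1 + (0 : E →L[ℝ] E)).det := by
    rw [add_zero, ContinuousLinearMap.det]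
    change 0 < LinearMap.det (LinearMap.id : E →ₗ[ℝ] E)
    simp
  obtain ⟨ε, hε, h⟩ := Metric.eventually_nhds_iff.1 (hc.continuousAt.eventually (lt_mem_nhds h0))
  exact ⟨ε, hε, fun A hA => h (by simpa using hA)⟩

theorem LipschitzWith.bijective_id_add {E : Type*} [NormedAddCommGroup E] [NormedSpace ℝ E]
    [CompleteSpace E] {h : E → E} {K : NNReal} (hh : LipschitzWith K h) (hK : K < 1) :
    Function.Bijective fun x => x + h x := by
  have ha : ApproximatesLinearOn (fun x => x + h x)
      ((ContinuousLinearEquiv.refl ℝ E : E ≃L[ℝ] E) : E →L[ℝ] E) univ K := by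
    intro x _ y _
    have := hh.dist_le_mul x y
    rw [dist_eq_norm, dist_eq_norm] at this
    have e : x + h x - (y + h y) - (x - y) = h x - h y := by abel
    exact (congrArg norm e).trans_le this
  have hc : Subsingleton E ∨
      K < ‖((ContinuousLinearEquiv.refl ℝ E).symm : E →L[ℝ] E)‖₊⁻¹ := by
    rcases subsingleton_or_nontrivial E with hE | hE
    · exact Or.inl hE
    · right
      simpa using hK
  exact ⟨injOn_univ.1 (ha.injOn hc), ha.surjective hc⟩

/-- Differentiating ‖r‖² = c² puts the range of `r'` in the orthogonal complement of `r x ≠ 0`, so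
`r'` is not surjective. -/
theorem det_fderiv_eq_zero_of_norm_eq {E : Type*} [NormedAddCommGroup E]
    [InnerProductSpace ℝ E] [FiniteDimensional ℝ E] {r : E → E} {r' : E →L[ℝ] E} {x : E} {c : ℝ}
    (hc : c ≠ 0) (hr : HasFDerivAt r r' x) (h : ∀ᶠ y in 𝓝 x, ‖r y‖ = c) : r'.det = 0 := by
  have hx : ‖r x‖ = c := h.self_of_nhds
  have key (v : E) : inner ℝ (r x) (r' v) = 0 := by
    have h1 : HasFDerivAt (fun y => ‖r y‖ ^ 2) (0 : E →L[ℝ] ℝ) x :=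
      (hasFDerivAt_const (c ^ 2) x).congr_of_eventuallyEq (h.mono fun y hy => by simp [hy])
    have := congrArg (· v) (hr.norm_sq.unique h1)
    simpa using this
  by_contra hdet
  have hs : Function.Surjective r' := by
    rw [← r'.coe_toContinuousLinearEquivOfDetNeZero hdet]
    exact (r'.toContinuousLinearEquivOfDetNeZero hdet).surjective
  obtain ⟨v, hv⟩ := hs (r x)
  have := key v
  rw [hv, inner_self_eq_zero] at this
  rw [this, norm_zero] at hx
  exact hc hx.symm

/-- There is no `C¹` retraction of the closed unit ball onto the unit sphere. -/
theorem not_exists_contDiff_retraction {E : Type*} [NormedAddCommGroup E]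
    [InnerProductSpace ℝ E] [FiniteDimensional ℝ E] {r : E → E} (hr : ContDiff ℝ 1 r)
    (h1 : ∀ x, ‖r x‖ = 1) (hid : ∀ x, ‖x‖ = 1 → r x = x) : False := by
  borelize E
  set d := Module.finrank ℝ E
  have hg : ContDiff ℝ 1 fun x => r x - x := hr.sub contDiff_id
  obtain ⟨K, hK⟩ := hg.contDiffOn (s := closedBall (0 : E) 1) |>.exists_lipschitzOnWith one_ne_zero
    (convex_closedBall _ _) (isCompact_closedBall _ _)
  -- Extends r - id to a globally Lipschitz map vanishing off the open ball.
  set h : E → E := fun x => r (unitBallProj x) - unitBallProj x with h_def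
  have hhL : LipschitzWith (K * 2) h := by
    have := hK.comp (lipschitzWith_unitBallProj (E := E)).lipschitzOnWith (s := univ)
      (fun x _ => by simpa using norm_unitBallProj_le x)
    exact lipschitzOnWith_univ.1 this
  have hh0 (x : E) (hx : 1 ≤ ‖x‖) : h x = 0 := by
    simp [h_def, hid _ (norm_unitBallProj_of_one_le hx)]
  obtain ⟨ε, hε, hdet⟩ := exists_pos_forall_det_one_add_pos (E := E)
  set D : E → E →L[ℝ] E := fun x => fderiv ℝ r x - 1 with D_def
  have hD (x : E) (hx : x ∈ ball (0 : E) 1) : HasFDerivAt h (D x) x := by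
    have h2 : HasFDerivAt (fun y => r y - y) (D x) x :=
      (hr.differentiable one_ne_zero x).hasFDerivAt.sub (hasFDerivAt_id x)
    refine h2.congr_of_eventuallyEq ?_
    filter_upwards [isOpen_ball.mem_nhds hx] with y hy
    simp only [h_def]
    rw [unitBallProj_of_norm_le (by simpa using (mem_ball_zero_iff.1 hy).le)]
  have hDK (x : E) (hx : x ∈ ball (0 : E) 1) : ‖D x‖ ≤ K * 2 := by
    simpa using (hD x hx).le_of_lipschitz hhL
  -- small perturbations of the identity preserve the unit ball
  have small (t : ℝ) (ht : 0 < t) (ht1 : t * (K * 2) < 1) (htε : t * (K * 2) < ε) :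
      IntegrableOn (fun x => (1 + t • D x).det) (ball (0 : E) 1) ∧
      ∫ x in ball (0 : E) 1, (1 + t • D x).det = volume.real (ball (0 : E) 1) := by
    have hbij : Function.Bijective fun x => x + t • h x := by
      have hL : LipschitzWith (‖t‖₊ * (K * 2)) fun x => t • h x := by
        simpa using! (lipschitzWith_smul t).comp hhL
      refine hL.bijective_id_add ?_
      rw [← NNReal.coe_lt_coe]
      simpa [abs_of_pos ht] using ht1
    -- A bijection of `E` that is the identity off the ball maps the ball onto itself.
    have himg : (fun x => x + t • h x) '' ball 0 1 = ball 0 1 := by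
      have hc : (fun x => x + t • h x) '' (ball 0 1)ᶜ = (ball 0 1)ᶜ := by
        conv_rhs => rw [← image_id (ball (0 : E) 1)ᶜ]
        refine image_congr fun x hx => ?_
        rw [hh0 x (by simpa using hx)]
        simp
      rw [image_compl_eq hbij, compl_inj_iff] at hc
      exact hc
    have hder (x : E) (hx : x ∈ ball (0 : E) 1) : HasFDerivWithinAt (fun x => x + t • h x)
        (1 + t • D x) (ball 0 1) x :=
      ((hasFDerivAt_id x).add ((hD x hx).const_smul t)).hasFDerivWithinAt
    have habs (x : E) (hx : x ∈ ball (0 : E) 1) : |(1 + t • D x).det| = (1 + t • D x).det := by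
      refine abs_of_pos (hdet _ ?_)
      rw [norm_smul, Real.norm_of_nonneg ht.le]
      exact (mul_le_mul_of_nonneg_left (hDK x hx) ht.le).trans_lt htε
    have hi := integrableOn_image_iff_integrableOn_abs_det_fderiv_smul volume measurableSet_ball
      hder hbij.injective.injOn (fun _ => (1 : ℝ))
    have hint := integral_image_eq_integral_abs_det_fderiv_smul volume measurableSet_ball
      hder hbij.injective.injOn (fun _ => (1 : ℝ))
    rw [himg] at hi hint
    simp only [smul_eq_mul, mul_one] at hi hint
    rw [integrableOn_congr_fun habs measurableSet_ball] at hi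
    rw [setIntegral_congr_fun measurableSet_ball habs] at hint
    refine ⟨hi.1 (integrableOn_const measure_ball_lt_top.ne), ?_⟩
    rw [← hint]
    simp
  obtain ⟨τ, hτ, hτ1, hτε⟩ : ∃ τ : ℝ, 0 < τ ∧ τ * (K * 2) < 1 ∧ τ * (K * 2) < ε := by
    -- The `+ 1` covers `K = 0` and makes the bounds strict.
    refine ⟨min 1 ε / (K * 2 + 1), by positivity, ?_, ?_⟩ <;>
    · rw [div_mul_eq_mul_div, div_lt_iff₀ (by positivity)]
      have h1 := min_le_left 1 ε
      have h2 := min_le_right 1 ε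
      have h3 : 0 < min 1 ε := by positivity
      have hK0 : (0 : ℝ) ≤ K := K.2
      nlinarith
  let v : ℕ → ℝ := fun i => τ / (i + 1)
  have hv : InjOn v (Finset.range (d + 1)) := by
    intro i _ j _ hij
    have hi : (i : ℝ) + 1 ≠ 0 := by positivity
    have hj : (j : ℝ) + 1 ≠ 0 := by positivity
    simp only [v] at hij
    rw [div_eq_div_iff hi hj] at hij
    have := mul_left_cancel₀ hτ.ne' hij
    exact_mod_cast (add_right_cancel this).symm
  have hvs (i : ℕ) := by
    have hv0 : 0 < v i := by positivity
    have hvτ : v i ≤ τ := div_le_self hτ.le (by simp)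
    have hle : v i * (K * 2) ≤ τ * (K * 2) := by gcongr
    exact small (v i) hv0 (hle.trans_lt hτ1) (hle.trans_lt hτε)
  have hzero : ∫ x in ball (0 : E) 1, (1 + D x).det = 0 := by
    refine integral_eq_zero_of_ae (ae_of_all _ fun x => ?_)
    rw [D_def]
    simp only [add_sub_cancel, Pi.zero_apply]
    exact det_fderiv_eq_zero_of_norm_eq one_ne_zero
      (hr.differentiable one_ne_zero x).hasFDerivAt (Eventually.of_forall h1)
  have hvol : ∫ x in ball (0 : E) 1, (1 + D x).det = volume.real (ball (0 : E) 1) := by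
    rw [setIntegral_congr_fun measurableSet_ball fun x _ =>
      ContinuousLinearMap.det_one_add_eq_sum_lagrange hv (D x)]
    rw [integral_finsetSum _ fun i _ => (hvs i).1.mul_const _]
    simp_rw [integral_mul_const, (hvs _).2]
    -- All nodes give the same volume and the Lagrange basis sums to 1.
    rw [← Finset.mul_sum, ← Polynomial.eval_finsetSum, Lagrange.sum_basis hv (by simp)]
    simp
  have hpos : 0 < volume.real (ball (0 : E) 1) :=
    ENNReal.toReal_pos (measure_ball_pos _ _ one_pos).ne' measure_ball_lt_top.ne
  linarith

/-! ### Brouwer's theorem by smoothing -/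

/-- A form of **Brouwer's fixed point theorem**: a continuous map which is within distance `s < 1`
of the identity on the closed unit ball vanishes somewhere on that ball. -/
theorem exists_eq_zero_of_norm_sub_le {E : Type*} [NormedAddCommGroup E]
    [InnerProductSpace ℝ E] [FiniteDimensional ℝ E] {f : E → E} {s : ℝ} (hs : s < 1)
    (hf : ContinuousOn f (closedBall 0 1)) (hfs : ∀ x, ‖x‖ ≤ 1 → ‖f x - x‖ ≤ s) :
    ∃ x, ‖x‖ ≤ 1 ∧ f x = 0 := by
  by_contra! hne
  have hPc : Continuous (unitBallProj : E → E) := lipschitzWith_unitBallProj.continuous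
  -- The cutoff is 1 on the unit ball and 0 beyond radius 2, so `F` is already smooth near ‖x‖ ≥ 3.
  set χ : E → ℝ := fun x => max 0 (min 1 (2 - ‖x‖)) with χ_def
  have hχc : Continuous χ := by fun_prop
  have hχ0 (x : E) : 0 ≤ χ x := le_max_left _ _
  have hχ1 (x : E) : χ x ≤ 1 := max_le zero_le_one (min_le_left _ _)
  set F : E → E := fun x => x + χ x • (f (unitBallProj x) - unitBallProj x) with F_def
  have hFc : Continuous F := by
    have : Continuous fun x => f (unitBallProj x) :=
      hf.comp_continuous hPc fun x => by simpa using norm_unitBallProj_le x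
    exact continuous_id.add (hχc.smul (this.sub hPc))
  have hF0 (x : E) : F x ≠ 0 := by
    rcases le_total ‖x‖ 1 with hx | hx
    · have : χ x = 1 := by
        rw [χ_def]
        simp only
        rw [min_eq_left (by linarith), max_eq_right zero_le_one]
      simpa [F_def, this, unitBallProj_of_norm_le hx] using hne x hx
    · intro h0
      have h2 : ‖χ x • (f (unitBallProj x) - unitBallProj x)‖ ≤ s := by
        rw [norm_smul, Real.norm_of_nonneg (hχ0 x)]
        exact (mul_le_of_le_one_left (norm_nonneg _) (hχ1 x)).trans
          (hfs _ (norm_unitBallProj_le x))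
      have h3 : x = -(χ x • (f (unitBallProj x) - unitBallProj x)) := eq_neg_of_add_eq_zero_left h0
      rw [h3, norm_neg] at hx
      linarith
  have hFid (x : E) (hx : 2 ≤ ‖x‖) : F x = x := by
    have : χ x = 0 := max_eq_left ((min_le_right _ _).trans (by linarith))
    simp [F_def, this]
  have hS : IsClosed {x : E | 3 ≤ ‖x‖} := isClosed_le continuous_const continuous_norm
  have hU : IsOpen {x : E | 2 < ‖x‖} := isOpen_lt continuous_const continuous_norm
  -- An error smaller than ‖F x‖ keeps `g` nonzero; normalizing `g` after rescaling radius 3 to 1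
  -- gives a forbidden retraction.
  obtain ⟨g, hg, hgF, hgS, -⟩ := hFc.exists_contDiff_approx_and_eqOn 1 hFc.norm
    (fun x => norm_pos_iff.2 (hF0 x)) hS
    (hU.mem_nhdsSet.2 fun x (hx : 3 ≤ ‖x‖) => show 2 < ‖x‖ by linarith)
    (contDiffOn_id.congr fun x (hx : 2 < ‖x‖) => hFid x hx.le)
  have hg0 (x : E) : g x ≠ 0 := by
    intro h
    have := hgF x
    simp [h] at this
  have hg3 : ContDiff ℝ 1 fun x : E => g ((3 : ℝ) • x) := hg.comp (contDiff_id.const_smul (3 : ℝ))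
  refine not_exists_contDiff_retraction (r := fun x : E => ‖g ((3 : ℝ) • x)‖⁻¹ • g ((3 : ℝ) • x))
    (((hg3.norm ℝ fun x => hg0 _).inv fun x => norm_ne_zero_iff.2 (hg0 _)).smul hg3) ?_ ?_
  · intro x
    rw [norm_smul, norm_inv, norm_norm, inv_mul_cancel₀ (norm_ne_zero_iff.2 (hg0 _))]
  · intro x hx
    have h3 : ‖(3 : ℝ) • x‖ = 3 := by rw [norm_smul, hx]; norm_num
    have : g ((3 : ℝ) • x) = (3 : ℝ) • x := (hgS h3.ge).trans (hFid _ (by rw [h3]; norm_num))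
    simp only [this, h3, smul_smul]
    norm_num

theorem exists_eq_zero_of_norm_sub_le_half {E : Type*} [NormedAddCommGroup E]
    [InnerProductSpace ℝ E] [FiniteDimensional ℝ E] {f : E → E} {R : ℝ} (hR : 0 < R)
    (hf : ContinuousOn f (closedBall 0 R)) (hfs : ∀ x, ‖x‖ ≤ R → ‖f x - x‖ ≤ R / 2) :
    ∃ x, ‖x‖ ≤ R ∧ f x = 0 := by
  have hsm (x : E) (hx : ‖x‖ ≤ 1) : ‖R • x‖ ≤ R := by
    rw [norm_smul, Real.norm_of_nonneg hR.le]
    exact mul_le_of_le_one_right hR.le hx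
  obtain ⟨x, hx, h0⟩ := exists_eq_zero_of_norm_sub_le (f := fun x => R⁻¹ • f (R • x))
    (s := 1 / 2) (by norm_num)
    ((hf.comp (continuous_const_smul R).continuousOn
      fun x hx => by simpa using hsm x (by simpa using hx)).const_smul R⁻¹) fun x hx => by
      have e : R⁻¹ • f (R • x) - x = R⁻¹ • (f (R • x) - R • x) := by
        rw [smul_sub, inv_smul_smul₀ hR.ne']
      rw [e, norm_smul, norm_inv, Real.norm_of_nonneg hR.le, inv_mul_le_iff₀ hR]
      linarith [hfs _ (hsm x hx)]
  exact ⟨R • x, hsm x hx, (smul_eq_zero.1 h0).resolve_left (inv_ne_zero hR.ne')⟩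

/-! ### Zeros for nearby parameters and their selection -/

/-- Zeros of a continuous perturbation of a map which is close to the identity at the origin. -/
theorem eventually_exists_eq_zero {E X : Type*} [NormedAddCommGroup E]
    [InnerProductSpace ℝ E] [FiniteDimensional ℝ E] [TopologicalSpace X] {a₀ : X}
    {G : E × X → E} (hG : ∀ᶠ z in 𝓝 ((0 : E), a₀), ContinuousAt G z) (hG0 : G (0, a₀) = 0)
    (hd : HasFDerivAt (fun x => G (x, a₀)) (1 : E →L[ℝ] E) 0) :
    ∀ᶠ ε in 𝓝[>] (0 : ℝ), ∀ᶠ a in 𝓝 a₀, ∃ x, ‖x‖ ≤ ε ∧ G (x, a) = 0 := by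
  -- Half of the error budget ε/2; the variation in `a` takes the other ε/4.
  have hd' : ∀ᶠ x in 𝓝 (0 : E), ‖G (x, a₀) - x‖ ≤ 1 / 4 * ‖x‖ := by
    simpa [hG0] using hd.isLittleO.def (show (0 : ℝ) < 1 / 4 by norm_num)
  have hcx : ∀ᶠ x in 𝓝 (0 : E), ∀ᶠ z in 𝓝 (x, a₀), ContinuousAt G z :=
    (Continuous.prodMk_left a₀).continuousAt.eventually hG.eventually_nhds
  obtain ⟨R, hR, hRs⟩ := Metric.eventually_nhds_iff_ball.1 (hd'.and hcx)
  filter_upwards [Ioo_mem_nhdsGT hR] with ε hε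
  have hball (x : E) (hx : ‖x‖ ≤ ε) := hRs x (by simpa using hx.trans_lt hε.2)
  have hunif : ∀ᶠ a in 𝓝 a₀, ∀ x ∈ closedBall (0 : E) ε,
      ContinuousAt G (x, a) ∧ ‖G (x, a) - G (x, a₀)‖ ≤ ε / 4 := by
    refine (isCompact_closedBall (0 : E) ε).eventually_forall_of_forall_eventually fun x hx => ?_
    have hc := (hball x (by simpa using hx)).2
    have hswap : Tendsto Prod.swap (𝓝 (a₀, x)) (𝓝 (x, a₀)) := continuous_swap.continuousAt
    refine (hswap.eventually hc).and ?_
    have t1 : Tendsto (fun z : X × E => G (z.2, z.1)) (𝓝 (a₀, x)) (𝓝 (G (x, a₀))) :=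
      hc.self_of_nhds.tendsto.comp hswap
    have t2 : Tendsto (fun z : X × E => G (z.2, a₀)) (𝓝 (a₀, x)) (𝓝 (G (x, a₀))) :=
      hc.self_of_nhds.tendsto.comp
        (show Continuous fun z : X × E => (z.2, a₀) by fun_prop).continuousAt
    have t3 := (t1.sub t2).norm
    rw [sub_self, norm_zero] at t3
    exact (t3.eventually (gt_mem_nhds (show (0 : ℝ) < ε / 4 by linarith [hε.1]))).mono
      fun _ => le_of_lt
  filter_upwards [hunif] with a ha
  refine exists_eq_zero_of_norm_sub_le_half hε.1
    (fun x hx => ((ha x hx).1.comp (f := fun x : E => (x, a)) (by fun_prop)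
      ).continuousWithinAt) fun x hx => ?_
  have h1 := (ha x (by simpa using hx)).2
  have h2 := (hball x hx).1
  have h3 := norm_add_le (G (x, a) - G (x, a₀)) (G (x, a₀) - x)
  rw [sub_add_sub_cancel] at h3
  linarith

theorem lemma2p3 (m n : ℕ)
    (F : EuclideanSpace ℝ (Fin m) × EuclideanSpace ℝ (Fin n) → EuclideanSpace ℝ (Fin m))
    (U : Set (EuclideanSpace ℝ (Fin m) × EuclideanSpace ℝ (Fin n)))
    (hU : U ∈ nhds (0, 0))
    (hcont : ContinuousOn F U)
    (hF0 : F (0, 0) = 0)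
    (hdiff : DifferentiableAt ℝ (fun x : EuclideanSpace ℝ (Fin m) => F (x, 0)) 0)
    (hinv : (fderiv ℝ (fun x : EuclideanSpace ℝ (Fin m) => F (x, 0)) 0).IsInvertible) :
    ∃ r : ℝ, 0 < r ∧ ∃ δ : EuclideanSpace ℝ (Fin n) → EuclideanSpace ℝ (Fin m),
      (∀ a : EuclideanSpace ℝ (Fin n), ‖a‖ < r → F (δ a, a) = 0) ∧
      δ 0 = 0 ∧ ContinuousAt δ 0 := by
  obtain ⟨A, hA⟩ := hinv
  have hsymm (y : EuclideanSpace ℝ (Fin m)) : A.symm y = 0 ↔ y = 0 := A.symm.map_eq_zero_iff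
  have hev : ∀ᶠ ε in 𝓝[>] (0 : ℝ), ∀ᶠ a in 𝓝 (0 : EuclideanSpace ℝ (Fin n)),
      ∃ x, ‖x‖ ≤ ε ∧ F (x, a) = 0 := by
    have hd := A.symm.hasFDerivAt.comp (0 : EuclideanSpace ℝ (Fin m)) hdiff.hasFDerivAt
    rw [← hA, ContinuousLinearEquiv.coe_symm_comp_coe] at hd
    have := eventually_exists_eq_zero (G := fun z => A.symm (F z)) (a₀ := 0)
      ((eventually_mem_nhds_iff.2 hU).mono fun z hz =>
        A.symm.continuous.continuousAt.comp (hcont.continuousAt hz))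
      (by simp [hF0]) hd
    simpa only [hsymm] using this
  -- choose zeros of almost minimal norm
  have hmin (a : EuclideanSpace ℝ (Fin n)) : ∃ x, (∃ y, F (y, a) = 0) →
      F (x, a) = 0 ∧ ∀ y, F (y, a) = 0 → ‖x‖ ≤ ‖y‖ + ‖a‖ := by
    by_cases hne : ∃ y, F (y, a) = 0
    -- At `a = 0` the slack ‖a‖ vanishes, so the minimum must be attained; this forces `δ 0 = 0`.
    · rcases eq_or_ne a 0 with rfl | ha
      · exact ⟨0, fun _ => ⟨hF0, fun y _ => by simp⟩⟩
      · have hbdd : BddBelow (norm '' {y | F (y, a) = 0}) :=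
          ⟨0, by rintro _ ⟨y, -, rfl⟩; exact norm_nonneg y⟩
        obtain ⟨_, ⟨x, hx, rfl⟩, hlt⟩ := exists_lt_of_csInf_lt
          (Set.Nonempty.image norm hne) (lt_add_of_pos_right _ (norm_pos_iff.2 ha))
        exact ⟨x, fun _ => ⟨hx, fun y hy => hlt.le.trans
          (by gcongr; exact csInf_le hbdd ⟨y, hy, rfl⟩)⟩⟩
    · exact ⟨0, fun h => absurd h hne⟩
  choose δ hδ using hmin
  have hδ0 : δ 0 = 0 := by
    have := (hδ 0 ⟨0, hF0⟩).2 0 hF0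
    simpa using this
  obtain ⟨ε₀, hε₀⟩ := hev.exists
  obtain ⟨r, hr, hball⟩ := Metric.eventually_nhds_iff_ball.1 hε₀
  refine ⟨r, hr, δ, fun a ha => ?_, hδ0, ?_⟩
  · obtain ⟨x, -, hx⟩ := hball a (by simpa using ha)
    exact (hδ a ⟨x, hx⟩).1
  · rw [ContinuousAt, hδ0, Metric.tendsto_nhds]
    intro e he
    obtain ⟨ε, hε, hεe⟩ := (hev.and (Ioo_mem_nhdsGT (half_pos he))).exists
    filter_upwards [hε, Metric.ball_mem_nhds 0 (half_pos he)] with a ⟨x, hxε, hx⟩ ha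
    have h1 := (hδ a ⟨x, hx⟩).2 x hx
    rw [mem_ball_zero_iff] at ha
    rw [dist_zero_right]
    linarith [hεe.2]
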